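/- **Setting.** A vanilla RNN with weight matrices $U\in\mathbb R^{d_h\times d_h}$, $V\in\mathbb R^{d_y\times d_h}$, $W\in\mathbb R^{d_h\times d_x}$ and entry-wise activation $\sigma_h:\mathbb R\to\mathbb R$ maps an input sequence $X_t=(x_1,\dots,x_t)$, $x_j\in\mathbb R^{d_x}$, to $y_t=Vh_t\in\mathbb R^{d_y}$, where $h_0=0$ and $h_j=\sigma_h(Uh_{j-1}+Wx_j)$. Let $d=\max\{d_x,d_h,d_y\}\ge 2$. Let $\mathcal F_t$ be the class of all maps $f_t:X_t\mapsto y_t$ obtained from weights with $\|U\|_F\le B_U$, $\|V\|_F\le B_V$, $\|W\|_F\le B_W$. Assume that $\sigma_h$ is $\rho_h$-Lipschitz with $\sigma_h(0)=0$ (it may be unbounded), and that for every label $z\in\{1,\dots,K\}$ the loss $y\mapsto\ell(q(y),z)$ is $\rho$-Lipschitz on $\mathbb R^{d_y}$ with the Euclidean norm. Put $\mathcal F_{\ell,t}=\{(X_t,z)\mapsto\ell(q(f_t(X_t)),z):f_t\in\mathcal F_t\}$. Let $S=\{(X_{i,t},z_{i,t})\}_{i=1}^n$ be a sample of size $n$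 such that, at every time-step $j\le t$, the $d_x\times n$ matrix $(x_{1,j},\dots,x_{n,j})$ of the inputs of the whole sample has Frobenius norm at most $B_x$. The empirical Rademacher complexity of a class $\mathcal H$ is $$\mathfrak R_S(\mathcal H)=\mathbb E_\epsilon\Big[\sup_{h\in\mathcal H}\frac1n\sum_{i=1}^n\epsilon_ih(s_i)\Big],\qquad \epsilon_i\ \text{i.i.d. uniform on }\{-1,1\}.$$ Put $$c_t=\frac{(\rho_hB_U)^t-1}{\rho_hB_U-1},\quad b_t=\frac{t(\rho_hB_U)^{t-1}-c_t}{\rho_hB_U-1},\quad g_t=\rho_hB_xB_VB_W\max\{c_t,\rho_hB_Ub_t\},$$ and, for $M_U\ge 0$, $$c_t'=\frac{(\rho_hM_U)^t-1}{\rho_hM_U-1},\quad b_t'=\frac{t(\rho_hM_U)^{t-1}-c_t'}{\rho_hM_U-1},\quad g_t'=\rho_hB_xB_VB_W\max\{c_t',\rho_hB_Ub_t'\},$$ where the quotients are continued by their limits $t$ and $t(t-1)/2$ when $\rho_hB_U=1$, respectively $\rho_hM_U=1$. **Theorem 1.** There is an absolute constant $C>0$, and for every $r_0>0$ there is an integer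 $n_0\ge1$ depending only on $r_0$, such that for all $n\ge n_0$ and all data as above the following holds. (a) If $\rho_hB_xB_VB_Wc_t\ge r_0$, then $\mathcal F_{\ell,t}$ is bounded on $S$ and $$\mathfrak R_S(\mathcal F_{\ell,t})\le C\,\frac{\rho\, d\, g_t\sqrt{\log d}\,\log(\rho_hnB_xB_VB_Wc_t)}{n}.$$ (b) If $\rho_hB_xB_VB_Wc_t'\ge r_0$ and if $\mathcal F_t$ is restricted to networks whose spectral norm satisfies $\|U\|_\sigma\le M_U$ in addition, then $\mathcal F_{\ell,t}$ is bounded on $S$ and $$\mathfrak R_S(\mathcal F_{\ell,t})\le C\,\frac{\rho\, d\, g_t'\sqrt{\log d}\,\log(\rho_hnB_xB_VB_Wc_t')}{n}.$$ When $M_U\le B_U$, the expression on the right is at most the one in (a). -/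

import Mathlib

open scoped NNReal

noncomputable section

/-- Real Euclidean space of dimension `k`. -/
abbrev Vec (k : ℕ) : Type := EuclideanSpace ℝ (Fin k)

/-- The matrix-vector product `A v`, with Euclidean spaces as source and target. -/
def matAct {m k : ℕ} (A : Matrix (Fin m) (Fin k) ℝ) (v : Vec k) : Vec m :=
  WithLp.toLp 2 (A.mulVec (WithLp.ofLp v))

/-- The entry-wise application of an activation function to a vector. -/
def entrywise {k : ℕ} (σ : ℝ → ℝ) (v : Vec k) : Vec k :=
  WithLp.toLp 2 (fun i => σ (v i))

/-- The Frobenius norm of a real matrix. -/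
def frobNorm {m k : ℕ} (A : Matrix (Fin m) (Fin k) ℝ) : ℝ :=
  √(∑ i, ∑ j, A i j ^ 2)

/-- The spectral norm (largest singular value) of a square real matrix, i.e. its operator norm
for the Euclidean norm. -/
def specNorm {k : ℕ} (A : Matrix (Fin k) (Fin k) ℝ) : ℝ :=
  ‖Matrix.toEuclideanCLM (n := Fin k) (𝕜 := ℝ) A‖

/-- The hidden state after reading `t` inputs: `h₀ = 0`, `hₜ = σ (U hₜ₋₁ + W xₜ)`. -/
def rnnHidden {dx dh : ℕ} (σ : ℝ → ℝ) (U : Matrix (Fin dh) (Fin dh) ℝ)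
    (W : Matrix (Fin dh) (Fin dx) ℝ) : (t : ℕ) → (Fin t → Vec dx) → Vec dh
  | 0, _ => 0
  | t + 1, X =>
      entrywise σ (matAct U (rnnHidden σ U W t (Fin.init X)) + matAct W (X (Fin.last t)))

/-- The map `(x₁, …, xₜ) ↦ yₜ = V hₜ` computed by a vanilla recurrent network. -/
def rnnOutput {dx dh dy : ℕ} (σ : ℝ → ℝ) (U : Matrix (Fin dh) (Fin dh) ℝ)
    (V : Matrix (Fin dy) (Fin dh) ℝ) (W : Matrix (Fin dh) (Fin dx) ℝ) (t : ℕ)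
    (X : Fin t → Vec dx) : Vec dy :=
  matAct V (rnnHidden σ U W t X)

/-- The class of maps computed by vanilla recurrent networks whose weight matrices have bounded
Frobenius norms. -/
def rnnClass (dx dh dy : ℕ) (σ : ℝ → ℝ) (BU BV BW : ℝ) (t : ℕ) :
    Set ((Fin t → Vec dx) → Vec dy) :=
  {f | ∃ (U : Matrix (Fin dh) (Fin dh) ℝ) (V : Matrix (Fin dy) (Fin dh) ℝ)
      (W : Matrix (Fin dh) (Fin dx) ℝ),
      frobNorm U ≤ BU ∧ frobNorm V ≤ BV ∧ frobNorm W ≤ BW ∧ f = rnnOutput σ U V W t}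

/-- The subclass in which, moreover, the spectral norm of `U` is at most `MU`. -/
def rnnClassSpec (dx dh dy : ℕ) (σ : ℝ → ℝ) (BU MU BV BW : ℝ) (t : ℕ) :
    Set ((Fin t → Vec dx) → Vec dy) :=
  {f | ∃ (U : Matrix (Fin dh) (Fin dh) ℝ) (V : Matrix (Fin dy) (Fin dh) ℝ)
      (W : Matrix (Fin dh) (Fin dx) ℝ),
      frobNorm U ≤ BU ∧ specNorm U ≤ MU ∧ frobNorm V ≤ BV ∧ frobNorm W ≤ BW ∧
        f = rnnOutput σ U V W t}

/-- The loss class `{(X, z) ↦ ℓ (q (f X), z) : f ∈ F}`. -/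
def lossClass {𝒳 Y Q Z : Type*} (q : Y → Q) (loss : Q → Z → ℝ) (F : Set (𝒳 → Y)) :
    Set (𝒳 × Z → ℝ) :=
  (fun f p => loss (q (f p.1)) p.2) '' F

/-- The empirical Rademacher complexity of a class `H` on a sample `S` of size `n`. The
expectation over i.i.d. uniform signs is the average over all `2 ^ n` sign vectors. -/
def empRademacher {𝒮 : Type*} {n : ℕ} (H : Set (𝒮 → ℝ)) (S : Fin n → 𝒮) : ℝ :=
  (∑ ε : Fin n → ℤˣ,
    sSup ((fun h : 𝒮 → ℝ => (1 / (n : ℝ)) * ∑ i, ((ε i : ℤ) : ℝ) * h (S i)) '' H)) / 2 ^ n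

/-- The functions of `H` take values in one common bounded interval on the sample `S`. -/
def BoundedOnSample {𝒮 : Type*} {n : ℕ} (H : Set (𝒮 → ℝ)) (S : Fin n → 𝒮) : Prop :=
  ∃ M : ℝ, ∀ h ∈ H, ∀ i, |h (S i)| ≤ M

/-- The `dx × n` matrix of the inputs of all sample sequences at time-step `j`. -/
def inputsAt {dx t n : ℕ} {Z : Type*} (S : Fin n → (Fin t → Vec dx) × Z) (j : Fin t) :
    Matrix (Fin dx) (Fin n) ℝ :=
  Matrix.of fun k i => (S i).1 j k

/-- `(x ^ t - 1) / (x - 1)`, continued by its limit `t` at `x = 1`. -/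
def cCoef (x : ℝ) (t : ℕ) : ℝ :=
  if x = 1 then (t : ℝ) else (x ^ t - 1) / (x - 1)

/-- `(t x ^ (t - 1) - c) / (x - 1)`, where `c = (x ^ t - 1) / (x - 1)`, continued by its limit
`t (t - 1) / 2` at `x = 1`. -/
def bCoef (x : ℝ) (t : ℕ) : ℝ :=
  if x = 1 then (t : ℝ) * ((t : ℝ) - 1) / 2
  else ((t : ℝ) * x ^ (t - 1) - cCoef x t) / (x - 1)

/-- `ρₕ Bₓ B_V B_W c`, where `c` is evaluated at `ρₕ N` and `N` bounds the norm of `U`. -/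
def rCoef (ρh Bx BV BW N : ℝ) (t : ℕ) : ℝ :=
  ρh * Bx * BV * BW * cCoef (ρh * N) t

/-- `ρₕ Bₓ B_V B_W max {c, ρₕ B_U b}`, where `b`, `c` are evaluated at `ρₕ N` and `N` bounds
the norm of `U`: the Frobenius norm (`N = BU`) or the spectral norm (`N = MU`). -/
def gCoef (ρh Bx BU BV BW N : ℝ) (t : ℕ) : ℝ :=
  ρh * Bx * BV * BW * max (cCoef (ρh * N) t) (ρh * BU * bCoef (ρh * N) t)

/-- `ρ d g √(log d) log (ρₕ n Bₓ B_V B_W c) / n`. -/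
def rnnRate (ρ ρh Bx BU BV BW N : ℝ) (t d n : ℕ) : ℝ :=
  ρ * d * gCoef ρh Bx BU BV BW N t * √(Real.log d) *
    Real.log (n * rCoef ρh Bx BV BW N t) / n

end

/-! ### The geometric coefficients -/

/-! Attach to a network the vector in ℝⁿ of its losses on the sample. Because `Bx` bounds the whole
input matrix at each time-step, these vectors, centred at the losses of the output 0, lie in one
Euclidean ball of radius `ρ * rCoef`, with no factor √n. Moving every weight matrix by a relative
amount δ moves the vector by at most `3 * δ * ρ * gCoef`, since the error at one time-step obeys the
recurrence that defines `bCoef` and `cCoef`.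

A single discretisation scale then suffices. Cut each weight entry into 2dn + 1 cells, so that δ =
1/n inside a cell; at most 3d² entries give (2dn + 1)^(3d²) cells. One representative per cell costs
`√n * τ / n` by Cauchy–Schwarz, with τ of order ρg/n, and Massart's lemma on the representatives
costs ρg √(2 · 3d² log(2dn + 1)) / n. The hypothesis on `r₀` serves only to compare log n with the
logarithm in the rate. The Frobenius class is the spectral class with `MU = BU`, so one argument
proves both parts. -/

lemma cCoef_zero (x : ℝ) : cCoef x 0 = 0 := by
  simp [cCoef]

/-- This recurrence and the one for `bCoef` hold at x = 1 too. They yield sign and monotonicity by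
induction, and they match the step of the network. -/
lemma cCoef_succ (x : ℝ) (t : ℕ) : cCoef x (t + 1) = x * cCoef x t + 1 := by
  unfold cCoef
  split_ifs with h
  · subst h; push_cast; ring
  · have : x - 1 ≠ 0 := sub_ne_zero.mpr h
    field_simp
    ring

lemma bCoef_zero (x : ℝ) : bCoef x 0 = 0 := by
  simp [bCoef, cCoef]

lemma bCoef_succ (x : ℝ) (t : ℕ) : bCoef x (t + 1) = x * bCoef x t + cCoef x t := by
  unfold bCoef
  split_ifs with h
  · subst h; simp only [cCoef, if_true]; push_cast; ring
  · have h1 : x - 1 ≠ 0 := sub_ne_zero.mpr h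
    -- At t = 0 the exponent is truncated, but the factor t kills both sides.
    have h2 : (t : ℝ) * x ^ t = x * (t * x ^ (t - 1)) := by
      cases t with
      | zero => simp
      | succ s => rw [Nat.add_sub_cancel, pow_succ]; ring
    have h3 : cCoef x t * (x - 1) = x ^ t - 1 := by
      rw [cCoef, if_neg h, div_mul_cancel₀ _ h1]
    rw [cCoef_succ, Nat.add_sub_cancel, div_eq_iff h1, add_mul, mul_assoc x, div_mul_cancel₀ _ h1]
    push_cast
    linear_combination h2 - h3

lemma cCoef_nonneg {x : ℝ} (hx : 0 ≤ x) (t : ℕ) : 0 ≤ cCoef x t := by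
  induction t with
  | zero => rw [cCoef_zero]
  | succ t ih => rw [cCoef_succ]; positivity

lemma bCoef_nonneg {x : ℝ} (hx : 0 ≤ x) (t : ℕ) : 0 ≤ bCoef x t := by
  induction t with
  | zero => rw [bCoef_zero]
  | succ t ih => rw [bCoef_succ]; have := cCoef_nonneg hx t; positivity

lemma cCoef_mono {x y : ℝ} (hx : 0 ≤ x) (hxy : x ≤ y) (t : ℕ) : cCoef x t ≤ cCoef y t := by
  induction t with
  | zero => simp [cCoef_zero]
  | succ t ih =>
    rw [cCoef_succ, cCoef_succ]
    have := cCoef_nonneg hx t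
    have := hx.trans hxy
    gcongr

lemma bCoef_mono {x y : ℝ} (hx : 0 ≤ x) (hxy : x ≤ y) (t : ℕ) : bCoef x t ≤ bCoef y t := by
  induction t with
  | zero => simp [bCoef_zero]
  | succ t ih =>
    rw [bCoef_succ, bCoef_succ]
    have := bCoef_nonneg hx t
    have := hx.trans hxy
    have := cCoef_mono hx hxy t
    gcongr

lemma rCoef_le_gCoef {ρh Bx BU BV BW N : ℝ} (hρ : 0 ≤ ρh) (hx : 0 ≤ Bx) (hV : 0 ≤ BV)
    (hW : 0 ≤ BW) (t : ℕ) : rCoef ρh Bx BV BW N t ≤ gCoef ρh Bx BU BV BW N t := by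
  unfold rCoef gCoef
  gcongr
  exact le_max_left _ _

lemma rCoef_mono {ρh Bx BV BW M N : ℝ} (hρ : 0 ≤ ρh) (hx : 0 ≤ Bx) (hV : 0 ≤ BV)
    (hW : 0 ≤ BW) (hM : 0 ≤ M) (h : M ≤ N) (t : ℕ) :
    rCoef ρh Bx BV BW M t ≤ rCoef ρh Bx BV BW N t := by
  have := cCoef_mono (mul_nonneg hρ hM) (mul_le_mul_of_nonneg_left h hρ) t
  unfold rCoef
  gcongr

lemma gCoef_nonneg {ρh Bx BU BV BW N : ℝ} (hρ : 0 ≤ ρh) (hx : 0 ≤ Bx) (hV : 0 ≤ BV)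
    (hW : 0 ≤ BW) (hN : 0 ≤ N) (t : ℕ) : 0 ≤ gCoef ρh Bx BU BV BW N t := by
  have := cCoef_nonneg (mul_nonneg hρ hN) t
  exact le_trans (by unfold rCoef; positivity) (rCoef_le_gCoef hρ hx hV hW t)

lemma gCoef_mono {ρh Bx BU BV BW M N : ℝ} (hρ : 0 ≤ ρh) (hx : 0 ≤ Bx) (hU : 0 ≤ BU)
    (hV : 0 ≤ BV) (hW : 0 ≤ BW) (hM : 0 ≤ M) (h : M ≤ N) (t : ℕ) :
    gCoef ρh Bx BU BV BW M t ≤ gCoef ρh Bx BU BV BW N t := by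
  have h1 := mul_nonneg hρ hM
  have h2 := mul_le_mul_of_nonneg_left h hρ
  have := cCoef_mono h1 h2 t
  have := bCoef_mono h1 h2 t
  unfold gCoef
  gcongr

lemma rnnRate_mono {ρ ρh Bx BU BV BW M N : ℝ} (hρ' : 0 ≤ ρ) (hρ : 0 ≤ ρh) (hx : 0 ≤ Bx)
    (hU : 0 ≤ BU) (hV : 0 ≤ BV) (hW : 0 ≤ BW) (hM : 0 ≤ M) (h : M ≤ N) (t d n : ℕ)
    (hn : 1 ≤ n * rCoef ρh Bx BV BW M t) :
    rnnRate ρ ρh Bx BU BV BW M t d n ≤ rnnRate ρ ρh Bx BU BV BW N t d n := by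
  have h1 := gCoef_mono hρ hx hU hV hW hM h t
  have h2 := rCoef_mono hρ hx hV hW hM h t
  have h3 := gCoef_nonneg (BU := BU) hρ hx hV hW hM t
  have h4 := h3.trans h1
  have h5 : 0 ≤ Real.log (n * rCoef ρh Bx BV BW M t) := Real.log_nonneg hn
  have h6 : Real.log (n * rCoef ρh Bx BV BW M t) ≤ Real.log (n * rCoef ρh Bx BV BW N t) :=
    Real.log_le_log (by linarith) (by gcongr)
  unfold rnnRate
  gcongr

/-! ### Massart's lemma -/

/-- By independence the sum factors into terms 2 cosh(aᵢ), and cosh x ≤ exp(x²/2). -/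
lemma sum_signs_exp_le {n : ℕ} (a : Fin n → ℝ) :
    ∑ ε : Fin n → ℤˣ, Real.exp (∑ i, ((ε i : ℤ) : ℝ) * a i)
      ≤ 2 ^ n * Real.exp ((∑ i, a i ^ 2) / 2) := by
  have h1 : ∑ ε : Fin n → ℤˣ, Real.exp (∑ i, ((ε i : ℤ) : ℝ) * a i)
      = ∏ i, ∑ s : ℤˣ, Real.exp (((s : ℤ) : ℝ) * a i) := by
    rw [Finset.prod_univ_sum, Fintype.piFinset_univ]
    simp_rw [Real.exp_sum]
  have h2 : ∀ i, ∑ s : ℤˣ, Real.exp (((s : ℤ) : ℝ) * a i) = 2 * Real.cosh (a i) := by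
    intro i
    rw [show (Finset.univ : Finset ℤˣ) = {1, -1} from rfl, Finset.sum_pair (by decide), Real.cosh_eq]
    push_cast
    ring_nf
  rw [h1]
  simp_rw [h2]
  rw [Finset.prod_mul_distrib, Finset.prod_const, Finset.card_univ, Fintype.card_fin,
    Finset.sum_div, Real.exp_sum]
  gcongr with i
  exact Real.cosh_le_exp_half_sq _

lemma sum_signs_eq_zero {n : ℕ} (c : Fin n → ℝ) :
    ∑ ε : Fin n → ℤˣ, ∑ i, ((ε i : ℤ) : ℝ) * c i = 0 := by
  have h := Equiv.sum_comp (Equiv.neg (Fin n → ℤˣ)) (fun ε => ∑ i, ((ε i : ℤ) : ℝ) * c i)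
  have h' : ∑ ε : Fin n → ℤˣ, ∑ i, ((ε i : ℤ) : ℝ) * c i
      = - ∑ ε : Fin n → ℤˣ, ∑ i, ((ε i : ℤ) : ℝ) * c i := by
    nth_rewrite 1 [← h]
    simp [Finset.sum_neg_distrib]
  linarith

lemma sum_sign_mul_le {n : ℕ} (ε : Fin n → ℤˣ) (a : Fin n → ℝ) {τ : ℝ} (hτ : 0 ≤ τ)
    (ha : ∑ i, a i ^ 2 ≤ τ ^ 2) : ∑ i, ((ε i : ℤ) : ℝ) * a i ≤ √n * τ := by
  have h1 : ∑ i, ((ε i : ℤ) : ℝ) ^ 2 = n := by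
    have : ∀ i, ((ε i : ℤ) : ℝ) ^ 2 = 1 := by
      intro i
      rcases Int.units_eq_one_or (ε i) with h | h <;> simp [h]
    simp [this]
  calc _ ≤ √(∑ i, ((ε i : ℤ) : ℝ) ^ 2) * √(∑ i, a i ^ 2) :=
        Real.sum_mul_le_sqrt_mul_sqrt _ _ _
    _ ≤ √n * τ := by
        rw [h1]
        gcongr
        exact Real.sqrt_le_iff.mpr ⟨hτ, ha⟩

/-- Massart's lemma with a discretisation error. The maximum over representatives is dominated by a
sum of exponentials. Jensen's inequality is replaced by the tangent bound x ≤ A - 1 + exp(x - A),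
which is affine in the exponential and so can be averaged over the signs directly. -/
lemma empRademacher_range_le_of_pos {𝒮 ι J : Type*} [Nonempty ι] [Fintype J] {n : ℕ}
    (a : ι → 𝒮 → ℝ) (S : Fin n → 𝒮) (c : Fin n → ℝ) (φ : ι → J) {R τ L : ℝ} (hR : 0 < R)
    (hτ : 0 ≤ τ) (hL : 0 < L) (hJ : (Fintype.card J : ℝ) ≤ Real.exp L)
    (hc : ∀ p, ∑ i, (a p (S i) - c i) ^ 2 ≤ R ^ 2)
    (hφ : ∀ p p', φ p = φ p' → ∑ i, (a p (S i) - a p' (S i)) ^ 2 ≤ τ ^ 2) :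
    empRademacher (Set.range a) S ≤ 1 / n * (√n * τ + R * √(2 * L)) := by
  -- This `l` minimises L / l + l R² / 2; the minimum is R √(2L).
  set l : ℝ := √(2 * L) / R with hl
  have hl0 : 0 < l := by positivity
  set A : ℝ := L + l ^ 2 * R ^ 2 / 2 with hA
  -- Each cell is represented by a member of the class, so `hc` applies to it. An empty cell
  -- receives an arbitrary member, which is harmless.
  let w : J → Fin n → ℝ := fun j i => l * (a (Function.invFun φ j) (S i) - c i)
  let g : (Fin n → ℤˣ) → ℝ := fun ε => ∑ j, Real.exp (∑ i, ((ε i : ℤ) : ℝ) * w j i)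
  have hg : ∑ ε, g ε ≤ 2 ^ n * Real.exp A := by
    rw [Finset.sum_comm]
    calc _ ≤ ∑ _j : J, 2 ^ n * Real.exp (l ^ 2 * R ^ 2 / 2) := by
          refine Finset.sum_le_sum fun j _ => (sum_signs_exp_le (w j)).trans ?_
          have : ∑ i, w j i ^ 2 ≤ l ^ 2 * R ^ 2 := by
            simp only [w, mul_pow, ← Finset.mul_sum]
            gcongr
            exact hc _
          gcongr
      _ = 2 ^ n * (Fintype.card J * Real.exp (l ^ 2 * R ^ 2 / 2)) := by
          rw [Finset.sum_const, Finset.card_univ, nsmul_eq_mul]; ring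
      _ ≤ 2 ^ n * Real.exp A := by
          rw [hA, Real.exp_add]; gcongr
  have key : ∀ ε : Fin n → ℤˣ,
      sSup ((fun h : 𝒮 → ℝ => (1 / (n : ℝ)) * ∑ i, ((ε i : ℤ) : ℝ) * h (S i)) '' Set.range a)
        ≤ 1 / n * (∑ i, ((ε i : ℤ) : ℝ) * c i + √n * τ + (A - 1 + g ε * Real.exp (-A)) / l) := by
    intro ε
    refine csSup_le ((Set.range_nonempty a).image _) ?_
    rintro _ ⟨_, ⟨p, rfl⟩, rfl⟩
    set p' := Function.invFun φ (φ p) with hp'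
    have h1 := sum_sign_mul_le ε _ hτ (hφ p p' (Function.invFun_eq ⟨p, rfl⟩).symm)
    have h2 : l * ∑ i, ((ε i : ℤ) : ℝ) * (a p' (S i) - c i) ≤ A - 1 + g ε * Real.exp (-A) := by
      have h3 : l * ∑ i, ((ε i : ℤ) : ℝ) * (a p' (S i) - c i)
          = ∑ i, ((ε i : ℤ) : ℝ) * w (φ p) i := by
        rw [Finset.mul_sum]
        exact Finset.sum_congr rfl fun i _ => by simp only [w, hp']; ring
      have h4 : Real.exp (∑ i, ((ε i : ℤ) : ℝ) * w (φ p) i) ≤ g ε :=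
        Finset.single_le_sum (f := fun j => Real.exp (∑ i, ((ε i : ℤ) : ℝ) * w j i))
          (fun j _ => (Real.exp_pos _).le) (Finset.mem_univ (φ p))
      have h5 := Real.add_one_le_exp (∑ i, ((ε i : ℤ) : ℝ) * w (φ p) i + -A)
      rw [Real.exp_add] at h5
      have h6 := mul_le_mul_of_nonneg_right h4 (Real.exp_pos (-A)).le
      rw [h3]
      linarith
    rw [mul_comm, ← le_div_iff₀ hl0] at h2
    have h7 : ∑ i, ((ε i : ℤ) : ℝ) * a p (S i) = ∑ i, ((ε i : ℤ) : ℝ) * c i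
        + ∑ i, ((ε i : ℤ) : ℝ) * (a p (S i) - a p' (S i))
        + ∑ i, ((ε i : ℤ) : ℝ) * (a p' (S i) - c i) := by
      rw [← Finset.sum_add_distrib, ← Finset.sum_add_distrib]
      exact Finset.sum_congr rfl fun i _ => by ring
    simp only [h7]
    gcongr
  have hcard : (Finset.univ : Finset (Fin n → ℤˣ)).card = 2 ^ n := by
    simp
  unfold empRademacher
  rw [div_le_iff₀ (by positivity)]
  refine (Finset.sum_le_sum fun ε _ => key ε).trans ?_
  rw [← Finset.mul_sum, mul_assoc]
  gcongr
  -- The centre `c` averages to zero, so its size never enters the bound.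
  rw [Finset.sum_add_distrib, Finset.sum_add_distrib, sum_signs_eq_zero, ← Finset.sum_div,
    Finset.sum_add_distrib, Finset.sum_const, Finset.sum_const, hcard,
    nsmul_eq_mul, nsmul_eq_mul]
  push_cast
  have h8 : (∑ ε, g ε) * Real.exp (-A) ≤ 2 ^ n := by
    rw [Real.exp_neg, ← div_eq_mul_inv, div_le_iff₀ (Real.exp_pos _)]
    exact hg
  have h9 : A / l = R * √(2 * L) := by
    have hs : √(2 * L) ^ 2 = 2 * L := Real.sq_sqrt (by positivity)
    have hs0 : √(2 * L) ≠ 0 := by positivity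
    rw [hA, hl]
    generalize √(2 * L) = u at hs hs0
    field_simp
    linear_combination (-1 : ℝ) * hs
  have h10 : (2 ^ n * (A - 1) + (∑ ε, g ε) * Real.exp (-A)) / l ≤ 2 ^ n * (R * √(2 * L)) := by
    rw [← h9, ← mul_div_assoc]
    gcongr
    linarith
  rw [← Finset.sum_mul]
  linarith

/-- The radius 0, excluded above by the division by R, is reached by letting R' decrease to R. -/
lemma empRademacher_range_le {𝒮 ι J : Type*} [Nonempty ι] [Fintype J] {n : ℕ}
    (a : ι → 𝒮 → ℝ) (S : Fin n → 𝒮) (c : Fin n → ℝ) (φ : ι → J) {R τ L : ℝ} (hR : 0 ≤ R)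
    (hτ : 0 ≤ τ) (hL : 0 < L) (hJ : (Fintype.card J : ℝ) ≤ Real.exp L)
    (hc : ∀ p, ∑ i, (a p (S i) - c i) ^ 2 ≤ R ^ 2)
    (hφ : ∀ p p', φ p = φ p' → ∑ i, (a p (S i) - a p' (S i)) ^ 2 ≤ τ ^ 2) :
    empRademacher (Set.range a) S ≤ 1 / n * (√n * τ + R * √(2 * L)) := by
  have hcont : Filter.Tendsto (fun R' : ℝ => 1 / n * (√n * τ + R' * √(2 * L)))
      (nhdsWithin R (Set.Ioi R)) (nhds (1 / n * (√n * τ + R * √(2 * L)))) :=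
    Continuous.continuousWithinAt (by fun_prop)
  refine ge_of_tendsto hcont ?_
  filter_upwards [self_mem_nhdsWithin] with R' hR'
  have hR' : R < R' := hR'
  exact empRademacher_range_le_of_pos a S c φ (hR.trans_lt hR') hτ hL hJ
    (fun p => (hc p).trans (pow_le_pow_left₀ hR hR'.le 2)) hφ

/-! ### Matrix norms and stacked samples -/

lemma frobNorm_nonneg {m k : ℕ} (A : Matrix (Fin m) (Fin k) ℝ) : 0 ≤ frobNorm A :=
  Real.sqrt_nonneg _

lemma norm_matAct_le {m k : ℕ} (A : Matrix (Fin m) (Fin k) ℝ) (v : Vec k) :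
    ‖matAct A v‖ ≤ frobNorm A * ‖v‖ := by
  rw [EuclideanSpace.norm_eq, EuclideanSpace.norm_eq, frobNorm, ← Real.sqrt_mul (by positivity),
    Finset.sum_mul]
  refine Real.sqrt_le_sqrt (Finset.sum_le_sum fun i _ => ?_)
  simp only [Real.norm_eq_abs, sq_abs]
  exact Finset.sum_mul_sq_le_sq_mul_sq Finset.univ (A i) v

lemma norm_matAct_le_specNorm {k : ℕ} (A : Matrix (Fin k) (Fin k) ℝ) (v : Vec k) :
    ‖matAct A v‖ ≤ specNorm A * ‖v‖ :=
  (Matrix.toEuclideanCLM (n := Fin k) (𝕜 := ℝ) A).le_opNorm v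

lemma specNorm_le_frobNorm {k : ℕ} (A : Matrix (Fin k) (Fin k) ℝ) : specNorm A ≤ frobNorm A :=
  ContinuousLinearMap.opNorm_le_bound _ (frobNorm_nonneg A) (norm_matAct_le A)

lemma matAct_sub {m k : ℕ} (A : Matrix (Fin m) (Fin k) ℝ) (v w : Vec k) :
    matAct A (v - w) = matAct A v - matAct A w := by
  simp [matAct, Matrix.mulVec_sub]

lemma sub_matAct {m k : ℕ} (A B : Matrix (Fin m) (Fin k) ℝ) (v : Vec k) :
    matAct (A - B) v = matAct A v - matAct B v := by
  simp [matAct, Matrix.sub_mulVec]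

lemma norm_entrywise_sub_le {k : ℕ} {σ : ℝ → ℝ} {ρh : ℝ≥0} (hσ : LipschitzWith ρh σ)
    (v w : Vec k) : ‖entrywise σ v - entrywise σ w‖ ≤ ρh * ‖v - w‖ := by
  rw [EuclideanSpace.norm_eq, EuclideanSpace.norm_eq]
  refine Real.sqrt_le_iff.mpr ⟨by positivity, ?_⟩
  rw [mul_pow, Real.sq_sqrt (by positivity), Finset.mul_sum]
  refine Finset.sum_le_sum fun i _ => ?_
  rw [← mul_pow]
  have h := hσ.dist_le_mul (v i) (w i)
  rw [Real.dist_eq, Real.dist_eq] at h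
  simpa [entrywise] using pow_le_pow_left₀ (abs_nonneg _) h 2

/-- The vectors attached to the members of a sample, as one vector for the Euclidean norm. -/
def stack {n k : ℕ} (f : Fin n → Vec k) : PiLp 2 (fun _ : Fin n => Vec k) :=
  WithLp.toLp 2 f

lemma norm_stack_sq {n k : ℕ} (f : Fin n → Vec k) : ‖stack f‖ ^ 2 = ∑ i, ‖f i‖ ^ 2 := by
  rw [PiLp.norm_sq_eq_of_L2]
  rfl

lemma stack_add {n k : ℕ} (f g : Fin n → Vec k) :
    stack (fun i => f i + g i) = stack f + stack g :=
  rfl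

lemma norm_stack_le {n k m : ℕ} {f : Fin n → Vec k} {g : Fin n → Vec m} {c : ℝ} (hc : 0 ≤ c)
    (h : ∀ i, ‖f i‖ ≤ c * ‖g i‖) : ‖stack f‖ ≤ c * ‖stack g‖ := by
  refine le_of_sq_le_sq ?_ (by positivity)
  rw [mul_pow, norm_stack_sq, norm_stack_sq, Finset.mul_sum]
  refine Finset.sum_le_sum fun i _ => ?_
  rw [← mul_pow]
  exact pow_le_pow_left₀ (norm_nonneg _) (h i) 2

lemma norm_stack_inputsAt {dx t n : ℕ} {Z : Type*} (S : Fin n → (Fin t → Vec dx) × Z)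
    (j : Fin t) : ‖stack fun i => (S i).1 j‖ = frobNorm (inputsAt S j) := by
  rw [← Real.sqrt_sq (norm_nonneg _), norm_stack_sq, frobNorm, Finset.sum_comm]
  congr 1
  refine Finset.sum_congr rfl fun i _ => ?_
  rw [EuclideanSpace.norm_sq_eq]
  simp [inputsAt]

/-! ### Bounds on the hidden states and on the outputs -/

section Network

variable {dx dh dy n : ℕ} {σ : ℝ → ℝ} {ρh : ℝ≥0} {Bx BU BV BW MU δ : ℝ}

/-- One time-step turns a bound B for the stacked states into ρₕ(MU · B + BW · Bx), which is the
recurrence of `cCoef`. -/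
lemma norm_stack_rnnHidden_le (hσ : LipschitzWith ρh σ) (hσ0 : σ 0 = 0) (hMU : 0 ≤ MU)
    (hBW : 0 ≤ BW) {U : Matrix (Fin dh) (Fin dh) ℝ}
    {W : Matrix (Fin dh) (Fin dx) ℝ} (hU : specNorm U ≤ MU) (hW : frobNorm W ≤ BW) (t : ℕ)
    (X : Fin n → Fin t → Vec dx) (hX : ∀ j, ‖stack fun i => X i j‖ ≤ Bx) :
    ‖stack fun i => rnnHidden σ U W t (X i)‖ ≤ ρh * BW * Bx * cCoef (ρh * MU) t := by
  induction t with
  | zero =>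
    have : (stack fun i => rnnHidden σ U W 0 (X i)) = 0 := rfl
    simp [this, cCoef_zero]
  | succ t ih =>
    have ih' := ih (fun i => Fin.init (X i)) (fun j => hX j.castSucc)
    have h1 : ‖stack fun i => rnnHidden σ U W (t + 1) (X i)‖
        ≤ ρh * ‖stack fun i => matAct U (rnnHidden σ U W t (Fin.init (X i)))
            + matAct W (X i (Fin.last t))‖ := by
      refine norm_stack_le ρh.coe_nonneg fun i => ?_
      have h := norm_entrywise_sub_le hσ
        (matAct U (rnnHidden σ U W t (Fin.init (X i))) + matAct W (X i (Fin.last t))) 0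
      have h0 : entrywise σ (0 : Vec dh) = 0 := by
        ext i; simp [entrywise, hσ0]
      rw [h0, sub_zero, sub_zero] at h
      exact h
    have h2 : ‖stack fun i => matAct U (rnnHidden σ U W t (Fin.init (X i)))‖
        ≤ MU * ‖stack fun i => rnnHidden σ U W t (Fin.init (X i))‖ :=
      norm_stack_le hMU fun i => (norm_matAct_le_specNorm U _).trans (by gcongr)
    have h3 : ‖stack fun i => matAct W (X i (Fin.last t))‖ ≤ BW * Bx :=
      (norm_stack_le hBW fun i => (norm_matAct_le W _).trans (by gcongr)).trans
        (mul_le_mul_of_nonneg_left (hX (Fin.last t)) hBW)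
    have h4 := (norm_add_le _ _).trans
      (add_le_add (h2.trans (mul_le_mul_of_nonneg_left ih' hMU)) h3)
    rw [stack_add] at h1
    refine (h1.trans (mul_le_mul_of_nonneg_left h4 ρh.coe_nonneg)).trans_eq ?_
    rw [cCoef_succ]
    ring

/-- Write Uh - U'h' = U(h - h') + (U - U')h'. The old error is propagated by the spectral norm,
while the change of weights is measured in Frobenius norm; hence `MU` sits inside the coefficients
and `BU` in front of `bCoef`. The new errors come from h', of size `cCoef`, and from the input. -/
lemma norm_stack_rnnHidden_sub_le (hσ : LipschitzWith ρh σ) (hσ0 : σ 0 = 0)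
    (hMU : 0 ≤ MU) (hBU : 0 ≤ BU) (hBW : 0 ≤ BW) (hδ : 0 ≤ δ)
    {U U' : Matrix (Fin dh) (Fin dh) ℝ} {W W' : Matrix (Fin dh) (Fin dx) ℝ}
    (hU : specNorm U ≤ MU) (hU' : specNorm U' ≤ MU)
    (hW' : frobNorm W' ≤ BW) (hUU : frobNorm (U - U') ≤ δ * BU) (hWW : frobNorm (W - W') ≤ δ * BW)
    (t : ℕ) (X : Fin n → Fin t → Vec dx) (hX : ∀ j, ‖stack fun i => X i j‖ ≤ Bx) :
    ‖stack fun i => rnnHidden σ U W t (X i) - rnnHidden σ U' W' t (X i)‖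
      ≤ δ * (ρh * BW * Bx) * (cCoef (ρh * MU) t + ρh * BU * bCoef (ρh * MU) t) := by
  induction t with
  | zero =>
    have : (stack fun i => rnnHidden σ U W 0 (X i) - rnnHidden σ U' W' 0 (X i)) = 0 := by
      change stack (fun _ : Fin n => (0 : Vec dh) - 0) = 0
      simp only [sub_zero]
      rfl
    simp [this, cCoef_zero, bCoef_zero]
  | succ t ih =>
    set H : Fin n → Vec dh := fun i => rnnHidden σ U W t (Fin.init (X i)) with hH
    set H' : Fin n → Vec dh := fun i => rnnHidden σ U' W' t (Fin.init (X i)) with hH'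
    have ih' : ‖stack fun i => H i - H' i‖ ≤ _ :=
      ih (fun i => Fin.init (X i)) (fun j => hX j.castSucc)
    have hb : ‖stack H'‖ ≤ ρh * BW * Bx * cCoef (ρh * MU) t :=
      norm_stack_rnnHidden_le hσ hσ0 hMU hBW hU' hW' t (fun i => Fin.init (X i))
        (fun j => hX j.castSucc)
    have h1 : ‖stack fun i => rnnHidden σ U W (t + 1) (X i) - rnnHidden σ U' W' (t + 1) (X i)‖
        ≤ ρh * ‖stack fun i => (matAct U (H i - H' i) + matAct (U - U') (H' i))
            + matAct (W - W') (X i (Fin.last t))‖ := by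
      refine norm_stack_le ρh.coe_nonneg fun i => (norm_entrywise_sub_le hσ _ _).trans_eq ?_
      rw [matAct_sub, sub_matAct, sub_matAct]
      congr 2
      simp only [hH, hH']
      abel
    have h2 : ‖stack fun i => matAct U (H i - H' i)‖ ≤ MU * ‖stack fun i => H i - H' i‖ :=
      norm_stack_le hMU fun i => (norm_matAct_le_specNorm U _).trans (by gcongr)
    have h3 : ‖stack fun i => matAct (U - U') (H' i)‖ ≤ δ * BU * ‖stack H'‖ :=
      norm_stack_le (by positivity) fun i => (norm_matAct_le _ _).trans (by gcongr)
    have h4 : ‖stack fun i => matAct (W - W') (X i (Fin.last t))‖ ≤ δ * BW * Bx :=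
      (norm_stack_le (by positivity) fun i => (norm_matAct_le _ _).trans (by gcongr)).trans
        (mul_le_mul_of_nonneg_left (hX (Fin.last t)) (by positivity))
    have h5 := (norm_add_le (stack fun i => matAct U (H i - H' i))
      (stack fun i => matAct (U - U') (H' i))).trans (add_le_add
      (h2.trans (mul_le_mul_of_nonneg_left ih' hMU))
      (h3.trans (mul_le_mul_of_nonneg_left hb (by positivity))))
    have h6 := (norm_add_le _ _).trans (add_le_add h5 h4)
    rw [stack_add, stack_add] at h1
    refine (h1.trans (mul_le_mul_of_nonneg_left h6 ρh.coe_nonneg)).trans_eq ?_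
    rw [cCoef_succ, bCoef_succ]
    ring

lemma norm_stack_rnnOutput_le (hσ : LipschitzWith ρh σ) (hσ0 : σ 0 = 0)
    (hMU : 0 ≤ MU) (hBV : 0 ≤ BV) (hBW : 0 ≤ BW) {U : Matrix (Fin dh) (Fin dh) ℝ}
    {V : Matrix (Fin dy) (Fin dh) ℝ} {W : Matrix (Fin dh) (Fin dx) ℝ} (hU : specNorm U ≤ MU)
    (hV : frobNorm V ≤ BV) (hW : frobNorm W ≤ BW) (t : ℕ)
    (X : Fin n → Fin t → Vec dx) (hX : ∀ j, ‖stack fun i => X i j‖ ≤ Bx) :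
    ‖stack fun i => rnnOutput σ U V W t (X i)‖ ≤ rCoef ρh Bx BV BW MU t := by
  have h1 : ‖stack fun i => rnnOutput σ U V W t (X i)‖
      ≤ BV * ‖stack fun i => rnnHidden σ U W t (X i)‖ :=
    norm_stack_le hBV fun i => (norm_matAct_le V _).trans (by gcongr)
  refine (h1.trans (mul_le_mul_of_nonneg_left
    (norm_stack_rnnHidden_le hσ hσ0 hMU hBW hU hW t X hX) hBV)).trans_eq ?_
  rw [rCoef]
  ring

lemma norm_stack_rnnOutput_sub_le (hσ : LipschitzWith ρh σ) (hσ0 : σ 0 = 0) (hBx : 0 ≤ Bx)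
    (hMU : 0 ≤ MU) (hBU : 0 ≤ BU) (hBV : 0 ≤ BV) (hBW : 0 ≤ BW) (hδ : 0 ≤ δ)
    {U U' : Matrix (Fin dh) (Fin dh) ℝ} {V V' : Matrix (Fin dy) (Fin dh) ℝ}
    {W W' : Matrix (Fin dh) (Fin dx) ℝ}
    (hU : specNorm U ≤ MU) (hU' : specNorm U' ≤ MU) (hV : frobNorm V ≤ BV)
    (hW' : frobNorm W' ≤ BW) (hUU : frobNorm (U - U') ≤ δ * BU)
    (hVV : frobNorm (V - V') ≤ δ * BV) (hWW : frobNorm (W - W') ≤ δ * BW)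
    (t : ℕ) (X : Fin n → Fin t → Vec dx) (hX : ∀ j, ‖stack fun i => X i j‖ ≤ Bx) :
    ‖stack fun i => rnnOutput σ U V W t (X i) - rnnOutput σ U' V' W' t (X i)‖
      ≤ 3 * δ * gCoef ρh Bx BU BV BW MU t := by
  set H : Fin n → Vec dh := fun i => rnnHidden σ U W t (X i) with hH
  set H' : Fin n → Vec dh := fun i => rnnHidden σ U' W' t (X i) with hH'
  have h0 : (fun i => rnnOutput σ U V W t (X i) - rnnOutput σ U' V' W' t (X i))
      = fun i => matAct V (H i - H' i) + matAct (V - V') (H' i) := by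
    funext i
    rw [matAct_sub, sub_matAct]
    simp only [rnnOutput, hH, hH']
    abel
  have h1 : ‖stack fun i => matAct V (H i - H' i)‖ ≤ BV * ‖stack fun i => H i - H' i‖ :=
    norm_stack_le hBV fun i => (norm_matAct_le _ _).trans (by gcongr)
  have h2 : ‖stack fun i => matAct (V - V') (H' i)‖ ≤ δ * BV * ‖stack H'‖ :=
    norm_stack_le (by positivity) fun i => (norm_matAct_le _ _).trans (by gcongr)
  have h3 := norm_stack_rnnHidden_sub_le hσ hσ0 hMU hBU hBW hδ hU hU' hW' hUU hWW t X hX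
  have h4 := norm_stack_rnnHidden_le hσ hσ0 hMU hBW hU' hW' t X hX
  have h5 := (norm_add_le _ _).trans (add_le_add
    (h1.trans (mul_le_mul_of_nonneg_left h3 hBV))
    (h2.trans (mul_le_mul_of_nonneg_left h4 (by positivity))))
  rw [h0, stack_add]
  refine h5.trans ?_
  set c := cCoef (ρh * MU) t
  set b := bCoef (ρh * MU) t
  -- One `c` comes from the change of W, the other from that of V, and `b` from that of U. Bounding
  -- each by the maximum gives the factor 3.
  calc _ = δ * (ρh * Bx * BV * BW * (c + c + ρh * BU * b)) := by ring
    _ ≤ δ * (ρh * Bx * BV * BW * (max c (ρh * BU * b) + max c (ρh * BU * b)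
          + max c (ρh * BU * b))) := by
        gcongr <;> first | exact le_max_left _ _ | exact le_max_right _ _
    _ = 3 * δ * gCoef ρh Bx BU BV BW MU t := by rw [gCoef]; ring

end Network

/-! ### Grid cells of the parameter set -/

/-- Rescale [-B, B] to [0, 2m] and take integer parts; the right endpoint accounts for the extra
cell. -/
lemma exists_grid_cell {B : ℝ} (hB : 0 ≤ B) (m : ℕ) :
    ∃ φ : ℝ → Fin (2 * m + 1), ∀ x y : ℝ, |x| ≤ B → |y| ≤ B → φ x = φ y →
      |x - y| * m ≤ B := by
  rcases hB.eq_or_lt with rfl | hB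
  · refine ⟨fun _ => 0, fun x y hx hy _ => ?_⟩
    simp [abs_nonpos_iff.mp hx, abs_nonpos_iff.mp hy]
  · have hcell : ∀ x : ℝ, |x| ≤ B → 0 ≤ (x / B + 1) * m ∧ (x / B + 1) * m ≤ 2 * m := by
      intro x hx
      have h := abs_le.mp hx
      have h1 : -1 ≤ x / B := by rw [le_div_iff₀ hB]; linarith
      have h2 : x / B ≤ 1 := by rw [div_le_iff₀ hB]; linarith
      exact ⟨mul_nonneg (by linarith) (by positivity), by gcongr; linarith⟩
    -- `Fin.ofNat` reduces modulo 2m + 1, which changes nothing for |x| ≤ B.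
    refine ⟨fun x => Fin.ofNat _ ⌊(x / B + 1) * m⌋₊, fun x y hx hy h => ?_⟩
    have hlt : ∀ x : ℝ, |x| ≤ B → ⌊(x / B + 1) * m⌋₊ < 2 * m + 1 := by
      intro x hx
      refine Nat.lt_succ_of_le (Nat.floor_le_of_le ?_)
      push_cast
      exact (hcell x hx).2
    have h' : ⌊(x / B + 1) * m⌋₊ = ⌊(y / B + 1) * m⌋₊ := by
      have := congrArg Fin.val h
      simpa [Fin.ofNat, Nat.mod_eq_of_lt (hlt x hx), Nat.mod_eq_of_lt (hlt y hy)] using this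
    have hx1 := Nat.floor_le (hcell x hx).1
    have hx2 := Nat.lt_floor_add_one ((x / B + 1) * m)
    have hy1 := Nat.floor_le (hcell y hy).1
    have hy2 := Nat.lt_floor_add_one ((y / B + 1) * m)
    rw [← h'] at hy1 hy2
    have h3 : |(x / B + 1) * m - (y / B + 1) * m| ≤ 1 := by
      rw [abs_le]; constructor <;> linarith
    have h4 : (x / B + 1) * m - (y / B + 1) * m = (x - y) * m / B := by field_simp; ring
    rw [h4, abs_div, abs_mul, abs_of_pos hB, Nat.abs_cast, div_le_one hB] at h3
    exact h3

lemma abs_apply_le_frobNorm {m k : ℕ} (A : Matrix (Fin m) (Fin k) ℝ) (i : Fin m) (j : Fin k) :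
    |A i j| ≤ frobNorm A := by
  refine Real.abs_le_sqrt ?_
  calc A i j ^ 2 ≤ ∑ j, A i j ^ 2 :=
        Finset.single_le_sum (f := fun j => A i j ^ 2) (fun _ _ => sq_nonneg _)
          (Finset.mem_univ j)
    _ ≤ _ := Finset.single_le_sum (f := fun i => ∑ j, A i j ^ 2)
          (fun _ _ => Finset.sum_nonneg fun _ _ => sq_nonneg _) (Finset.mem_univ i)

/-- With mesh B/(dN), at most d² entries contribute at most d²(B/(dN))² = (B/N)² to the squared
Frobenius distance. -/
lemma exists_matrix_cell {m k d N : ℕ} (hm : m ≤ d) (hk : k ≤ d) (hd : 0 < d) (hN : 0 < N)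
    {B : ℝ} (hB : 0 ≤ B) :
    ∃ φ : Matrix (Fin m) (Fin k) ℝ → Fin m → Fin k → Fin (2 * (d * N) + 1),
      ∀ A A', frobNorm A ≤ B → frobNorm A' ≤ B → φ A = φ A' →
        frobNorm (A - A') ≤ 1 / N * B := by
  obtain ⟨ψ, hψ⟩ := exists_grid_cell hB (d * N)
  refine ⟨fun A i j => ψ (A i j), fun A A' hA hA' h => ?_⟩
  have hd' : (0 : ℝ) < d := by exact_mod_cast hd
  have hN' : (0 : ℝ) < N := by exact_mod_cast hN
  have hentry : ∀ i j, (A - A') i j ^ 2 ≤ (B / (d * N)) ^ 2 := by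
    intro i j
    have h1 := hψ (A i j) (A' i j) ((abs_apply_le_frobNorm A i j).trans hA)
      ((abs_apply_le_frobNorm A' i j).trans hA') (congrFun (congrFun h i) j)
    rw [← sq_abs, Matrix.sub_apply]
    push_cast at h1
    rw [← le_div_iff₀ (by positivity)] at h1
    gcongr
  refine Real.sqrt_le_iff.mpr ⟨by positivity, ?_⟩
  calc ∑ i, ∑ j, (A - A') i j ^ 2 ≤ ∑ _i : Fin m, ∑ _j : Fin k, (B / (d * N)) ^ 2 :=
        Finset.sum_le_sum fun i _ => Finset.sum_le_sum fun j _ => hentry i j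
    _ = (m * k) * (B / (d * N)) ^ 2 := by simp; ring
    _ ≤ (d * d) * (B / (d * N)) ^ 2 := by gcongr
    _ = (1 / N * B) ^ 2 := by field_simp

/-! ### The loss class of the networks -/

/-- The weights of the networks in `rnnClassSpec`. -/
def Weights (dx dh dy : ℕ) (BU MU BV BW : ℝ) : Type :=
  {p : Matrix (Fin dh) (Fin dh) ℝ × Matrix (Fin dy) (Fin dh) ℝ × Matrix (Fin dh) (Fin dx) ℝ //
    frobNorm p.1 ≤ BU ∧ specNorm p.1 ≤ MU ∧ frobNorm p.2.1 ≤ BV ∧ frobNorm p.2.2 ≤ BW}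

lemma frobNorm_zero {m k : ℕ} : frobNorm (0 : Matrix (Fin m) (Fin k) ℝ) = 0 := by
  simp [frobNorm]

lemma Weights.nonempty {dx dh dy : ℕ} {BU MU BV BW : ℝ} (hBU : 0 ≤ BU) (hMU : 0 ≤ MU)
    (hBV : 0 ≤ BV) (hBW : 0 ≤ BW) : Nonempty (Weights dx dh dy BU MU BV BW) :=
  ⟨⟨(0, 0, 0), by simpa [frobNorm_zero] using hBU, by simpa [specNorm] using hMU,
    by simpa [frobNorm_zero] using hBV, by simpa [frobNorm_zero] using hBW⟩⟩

lemma lossClass_rnnClassSpec_eq_range {dx dh dy : ℕ} {Q Z : Type*} (q : Vec dy → Q)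
    (loss : Q → Z → ℝ) (σ : ℝ → ℝ) (BU MU BV BW : ℝ) (t : ℕ) :
    lossClass q loss (rnnClassSpec dx dh dy σ BU MU BV BW t)
      = Set.range fun (p : Weights dx dh dy BU MU BV BW) (x : (Fin t → Vec dx) × Z) =>
          loss (q (rnnOutput σ p.1.1 p.1.2.1 p.1.2.2 t x.1)) x.2 := by
  ext h
  constructor
  · rintro ⟨_, ⟨U, V, W, hU, hM, hV, hW, rfl⟩, rfl⟩
    exact ⟨⟨(U, V, W), hU, hM, hV, hW⟩, rfl⟩
  · rintro ⟨⟨⟨U, V, W⟩, hU, hM, hV, hW⟩, rfl⟩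
    exact ⟨_, ⟨U, V, W, hU, hM, hV, hW, rfl⟩, rfl⟩

lemma rnnClass_eq_rnnClassSpec (dx dh dy : ℕ) (σ : ℝ → ℝ) (BU BV BW : ℝ) (t : ℕ) :
    rnnClass dx dh dy σ BU BV BW t = rnnClassSpec dx dh dy σ BU BU BV BW t := by
  ext f
  constructor
  · rintro ⟨U, V, W, hU, hV, hW, rfl⟩
    exact ⟨U, V, W, hU, (specNorm_le_frobNorm U).trans hU, hV, hW, rfl⟩
  · rintro ⟨U, V, W, hU, -, hV, hW, rfl⟩
    exact ⟨U, V, W, hU, hV, hW, rfl⟩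

lemma sum_loss_sub_sq_le {dy n : ℕ} {Q Z : Type*} {q : Vec dy → Q} {loss : Q → Z → ℝ}
    {ρ : ℝ≥0} (hloss : ∀ z, LipschitzWith ρ (fun y : Vec dy => loss (q y) z)) (y y' : Fin n → Vec dy)
    (z : Fin n → Z) {r : ℝ} (hr : ‖stack fun i => y i - y' i‖ ≤ r) :
    ∑ i, (loss (q (y i)) (z i) - loss (q (y' i)) (z i)) ^ 2 ≤ (ρ * r) ^ 2 := by
  calc ∑ i, (loss (q (y i)) (z i) - loss (q (y' i)) (z i)) ^ 2
      ≤ ∑ i, (ρ : ℝ) ^ 2 * ‖y i - y' i‖ ^ 2 := by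
        refine Finset.sum_le_sum fun i _ => ?_
        have h := (hloss (z i)).dist_le_mul (y i) (y' i)
        rw [Real.dist_eq, dist_eq_norm] at h
        rw [← mul_pow, ← sq_abs]
        gcongr
    _ = (ρ : ℝ) ^ 2 * ‖stack fun i => y i - y' i‖ ^ 2 := by
        rw [norm_stack_sq, Finset.mul_sum]
    _ ≤ (ρ * r) ^ 2 := by
        rw [mul_pow]
        gcongr

/-- Since 2dn + 1 ≤ (dn)², the logarithm is at most 2(log d + log n). The sum becomes a product
because log d ≥ 1/2 and log n ≥ 1. -/
lemma log_two_mul_mul_add_one_le {d n : ℕ} (hd : 2 ≤ d) (hn : 3 ≤ n) :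
    Real.log ((2 * (d * n) + 1 : ℕ) : ℝ) ≤ 6 * (Real.log d * Real.log n) := by
  have hd' : (2 : ℝ) ≤ d := by exact_mod_cast hd
  have hn' : (3 : ℝ) ≤ n := by exact_mod_cast hn
  have hld : 1 / 2 ≤ Real.log d := by
    have := Real.log_le_log (by norm_num) hd'
    have := Real.log_two_gt_d9
    linarith
  have hln : 1 ≤ Real.log n := by
    rw [Real.le_log_iff_exp_le (by linarith)]
    have := Real.exp_one_lt_d9
    linarith
  have h1 : ((2 * (d * n) + 1 : ℕ) : ℝ) ≤ (d * n) ^ 2 := by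
    have : (6 : ℝ) ≤ d * n := by nlinarith
    push_cast
    nlinarith
  calc _ ≤ Real.log ((d * n : ℝ) ^ 2) := Real.log_le_log (by positivity) h1
    _ = 2 * (Real.log d + Real.log n) := by
        rw [Real.log_pow, Real.log_mul (by positivity) (by positivity)]; norm_num
    _ ≤ 6 * (Real.log d * Real.log n) := by nlinarith

/-- From n r² ≥ 1 follows log r ≥ -(log n)/2: a small r costs at most half of log n. -/
lemma half_log_le_log_mul {n : ℕ} {r₀ r : ℝ} (hr₀ : 0 < r₀) (hr : r₀ ≤ r)
    (hn : 1 / r₀ ^ 2 ≤ n) : Real.log n / 2 ≤ Real.log (n * r) := by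
  have hn0 : (0 : ℝ) < n := lt_of_lt_of_le (by positivity) hn
  rw [div_le_iff₀ (by positivity)] at hn
  have h1 : (1 : ℝ) ≤ n * r ^ 2 := hn.trans (by gcongr)
  have h2 := Real.log_nonneg h1
  have hr' := hr₀.trans_le hr
  rw [Real.log_mul hn0.ne' (by positivity), Real.log_pow] at h2
  rw [Real.log_mul hn0.ne' hr'.ne']
  push_cast at h2
  linarith

/-! ### Boundedness, the discretised complexity bound and its constants -/

section Main

variable {dx dh dy n t : ℕ} {Q Z : Type*} {ρ ρh : ℝ≥0} {Bx BU BV BW MU : ℝ} {σ : ℝ → ℝ}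
  {q : Vec dy → Q} {loss : Q → Z → ℝ} {S : Fin n → (Fin t → Vec dx) × Z}

lemma sum_rnnLoss_sub_sq_le (hMU : 0 ≤ MU) (hBV : 0 ≤ BV) (hBW : 0 ≤ BW)
    (hS : ∀ j : Fin t, frobNorm (inputsAt S j) ≤ Bx) (hσ : LipschitzWith ρh σ) (hσ0 : σ 0 = 0)
    (hloss : ∀ z, LipschitzWith ρ (fun y : Vec dy => loss (q y) z))
    (p : Weights dx dh dy BU MU BV BW) :
    ∑ i, (loss (q (rnnOutput σ p.1.1 p.1.2.1 p.1.2.2 t (S i).1)) (S i).2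
      - loss (q 0) (S i).2) ^ 2 ≤ (ρ * rCoef ρh Bx BV BW MU t) ^ 2 := by
  refine sum_loss_sub_sq_le hloss (fun i => rnnOutput σ p.1.1 p.1.2.1 p.1.2.2 t (S i).1)
    (fun _ => 0) (fun i => (S i).2) ?_
  simp only [sub_zero]
  exact norm_stack_rnnOutput_le hσ hσ0 hMU hBV hBW p.2.2.1 p.2.2.2.1 p.2.2.2.2 t
    (fun i => (S i).1) fun j => (norm_stack_inputsAt S j).trans_le (hS j)

/-- This ensures that the suprema in `empRademacher` are genuine: a real `sSup` is 0 by convention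
on a set unbounded above. -/
lemma boundedOnSample_rnnClassSpec (hMU : 0 ≤ MU) (hBx : 0 ≤ Bx) (hBV : 0 ≤ BV) (hBW : 0 ≤ BW)
    (hS : ∀ j : Fin t, frobNorm (inputsAt S j) ≤ Bx) (hσ : LipschitzWith ρh σ) (hσ0 : σ 0 = 0)
    (hloss : ∀ z, LipschitzWith ρ (fun y : Vec dy => loss (q y) z)) :
    BoundedOnSample (lossClass q loss (rnnClassSpec dx dh dy σ BU MU BV BW t)) S := by
  have hr : 0 ≤ rCoef ρh Bx BV BW MU t := by
    have := cCoef_nonneg (mul_nonneg ρh.coe_nonneg hMU) t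
    exact mul_nonneg (by positivity) this
  refine ⟨(∑ i, |loss (q 0) (S i).2|) + ρ * rCoef ρh Bx BV BW MU t, ?_⟩
  rw [lossClass_rnnClassSpec_eq_range]
  rintro _ ⟨p, rfl⟩ i
  have h1 := sum_rnnLoss_sub_sq_le hMU hBV hBW hS hσ hσ0 hloss p
  have h2 := (Finset.single_le_sum (f := fun i =>
    (loss (q (rnnOutput σ p.1.1 p.1.2.1 p.1.2.2 t (S i).1)) (S i).2 - loss (q 0) (S i).2) ^ 2)
    (fun _ _ => sq_nonneg _) (Finset.mem_univ i)).trans h1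
  have h3 := abs_le_of_sq_le_sq h2 (mul_nonneg ρ.coe_nonneg hr)
  have h4 := Finset.single_le_sum (f := fun i => |loss (q 0) (S i).2|)
    (fun _ _ => abs_nonneg _) (Finset.mem_univ i)
  have h5 := abs_sub_abs_le_abs_sub
    (loss (q (rnnOutput σ p.1.1 p.1.2.1 p.1.2.2 t (S i).1)) (S i).2) (loss (q 0) (S i).2)
  beta_reduce
  linarith

lemma empRademacher_rnnClassSpec_le {d : ℕ} (hx : dx ≤ d) (hh : dh ≤ d) (hy : dy ≤ d)
    (hd : 0 < d) (hn : 0 < n) (hMU : 0 ≤ MU) (hBx : 0 ≤ Bx) (hBU : 0 ≤ BU) (hBV : 0 ≤ BV)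
    (hBW : 0 ≤ BW)
    (hS : ∀ j : Fin t, frobNorm (inputsAt S j) ≤ Bx) (hσ : LipschitzWith ρh σ) (hσ0 : σ 0 = 0)
    (hloss : ∀ z, LipschitzWith ρ (fun y : Vec dy => loss (q y) z)) :
    empRademacher (lossClass q loss (rnnClassSpec dx dh dy σ BU MU BV BW t)) S
      ≤ 1 / n * (√n * (ρ * (3 * (1 / n) * gCoef ρh Bx BU BV BW MU t))
        + ρ * gCoef ρh Bx BU BV BW MU t
          * √(2 * (3 * d ^ 2 * Real.log ((2 * (d * n) + 1 : ℕ) : ℝ)))) := by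
  have hg := gCoef_nonneg (BU := BU) ρh.coe_nonneg hBx hBV hBW hMU t
  have hr : 0 ≤ rCoef ρh Bx BV BW MU t :=
    mul_nonneg (by positivity) (cCoef_nonneg (mul_nonneg ρh.coe_nonneg hMU) t)
  have hrg := rCoef_le_gCoef (BU := BU) (N := MU) ρh.coe_nonneg hBx hBV hBW t
  obtain ⟨φU, hφU⟩ := exists_matrix_cell hh hh hd hn hBU
  obtain ⟨φV, hφV⟩ := exists_matrix_cell hy hh hd hn hBV
  obtain ⟨φW, hφW⟩ := exists_matrix_cell hh hx hd hn hBW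
  have := Weights.nonempty (dx := dx) (dh := dh) (dy := dy) hBU hMU hBV hBW
  have hdn : 0 < d * n := Nat.mul_pos hd hn
  rw [lossClass_rnnClassSpec_eq_range]
  refine empRademacher_range_le _ S (fun i => loss (q 0) (S i).2)
    (fun p => (φU p.1.1, φV p.1.2.1, φW p.1.2.2)) ?_ ?_ ?_ ?_ ?_ ?_
  · exact mul_nonneg ρ.coe_nonneg hg
  · exact mul_nonneg ρ.coe_nonneg (mul_nonneg (by positivity) hg)
  · have : 0 < Real.log ((2 * (d * n) + 1 : ℕ) : ℝ) :=
      Real.log_pos (by exact_mod_cast (by omega : 1 < 2 * (d * n) + 1))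
    positivity
  · have hcard : Fintype.card ((Fin dh → Fin dh → Fin (2 * (d * n) + 1))
        × (Fin dy → Fin dh → Fin (2 * (d * n) + 1)) × (Fin dh → Fin dx → Fin (2 * (d * n) + 1)))
        ≤ (2 * (d * n) + 1) ^ (3 * d ^ 2) := by
      simp only [Fintype.card_prod, Fintype.card_pi, Fintype.card_fin, Finset.prod_const,
        Finset.card_univ, ← pow_mul, ← pow_add]
      refine Nat.pow_le_pow_right (by omega) ?_
      have h1 := Nat.mul_le_mul hh hh
      have h2 := Nat.mul_le_mul hh hy
      have h3 := Nat.mul_le_mul hx hh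
      linarith [sq d]
    have h0 : (0 : ℝ) < ((2 * (d * n) + 1 : ℕ) : ℝ) := by positivity
    calc _ ≤ (((2 * (d * n) + 1) ^ (3 * d ^ 2) : ℕ) : ℝ) := by exact_mod_cast hcard
      _ = Real.exp (3 * d ^ 2 * Real.log ((2 * (d * n) + 1 : ℕ) : ℝ)) := by
        rw [show (3 * (d : ℝ) ^ 2) = ((3 * d ^ 2 : ℕ) : ℝ) by push_cast; rfl, ← Real.log_pow,
          Real.exp_log (pow_pos h0 _), Nat.cast_pow]
  -- The radius `ρ * rCoef` is enlarged to `ρ * gCoef`, the quantity that also controls the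
  -- discretisation error.
  · intro p
    refine (sum_rnnLoss_sub_sq_le hMU hBV hBW hS hσ hσ0 hloss p).trans ?_
    gcongr
  · intro p p' h
    simp only [Prod.mk.injEq] at h
    exact sum_loss_sub_sq_le hloss (fun i => rnnOutput σ p.1.1 p.1.2.1 p.1.2.2 t (S i).1)
      (fun i => rnnOutput σ p'.1.1 p'.1.2.1 p'.1.2.2 t (S i).1) (fun i => (S i).2)
      (norm_stack_rnnOutput_sub_le hσ hσ0 hBx hMU hBU hBV hBW (by positivity) p.2.2.1 p'.2.2.1
        p.2.2.2.1 p'.2.2.2.2 (hφU _ _ p.2.1 p'.2.1 h.1) (hφV _ _ p.2.2.2.1 p'.2.2.2.1 h.2.1)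
        (hφW _ _ p.2.2.2.2 p'.2.2.2.2 h.2.2) t (fun i => (S i).1)
        fun j => (norm_stack_inputsAt S j).trans_le (hS j))

lemma empRademacher_rnnClassSpec_le_rnnRate {d : ℕ} {r₀ : ℝ} (hx : dx ≤ d) (hh : dh ≤ d)
    (hy : dy ≤ d) (hd : 2 ≤ d) (hn : 3 ≤ n) (hr₀ : 0 < r₀) (hnr : 1 / r₀ ^ 2 ≤ (n : ℝ))
    (hMU : 0 ≤ MU) (hBx : 0 ≤ Bx)
    (hBU : 0 ≤ BU) (hBV : 0 ≤ BV) (hBW : 0 ≤ BW)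
    (hS : ∀ j : Fin t, frobNorm (inputsAt S j) ≤ Bx) (hσ : LipschitzWith ρh σ) (hσ0 : σ 0 = 0)
    (hloss : ∀ z, LipschitzWith ρ (fun y : Vec dy => loss (q y) z))
    (hr : r₀ ≤ rCoef ρh Bx BV BW MU t) :
    empRademacher (lossClass q loss (rnnClassSpec dx dh dy σ BU MU BV BW t)) S
      ≤ 18 * rnnRate ρ ρh Bx BU BV BW MU t d n := by
  have hd' : (2 : ℝ) ≤ d := by exact_mod_cast hd
  have hn' : (3 : ℝ) ≤ n := by exact_mod_cast hn
  have hg := gCoef_nonneg (BU := BU) ρh.coe_nonneg hBx hBV hBW hMU t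
  refine (empRademacher_rnnClassSpec_le hx hh hy (by omega) (by omega) hMU hBx hBU hBV hBW hS hσ
    hσ0 hloss).trans ?_
  rw [rnnRate]
  set g := gCoef ρh Bx BU BV BW MU t
  set s := √(Real.log d) with hs
  set l := Real.log (n * rCoef ρh Bx BV BW MU t)
  have hln : 1 ≤ Real.log n := by
    rw [Real.le_log_iff_exp_le (by linarith)]
    have := Real.exp_one_lt_d9
    linarith
  have hl : Real.log n / 2 ≤ l := half_log_le_log_mul hr₀ hr hnr
  have hld : 1 / 2 ≤ Real.log d := by
    have := Real.log_le_log (by norm_num) hd'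
    have := Real.log_two_gt_d9
    linarith
  have hs2 : s ^ 2 = Real.log d := Real.sq_sqrt (by linarith)
  have hl0 : 0 < l := by linarith
  have hs' : 1 / 2 ≤ s := Real.le_sqrt_of_sq_le (by linarith)
  have h1 : √(n : ℝ) * (3 * (1 / n)) ≤ 6 * (d * s * l) := by
    have h2 : √(n : ℝ) ≤ n := Real.sqrt_le_iff.mpr ⟨by positivity, by nlinarith⟩
    have h3 : √(n : ℝ) * (3 * (1 / n)) ≤ 3 := by
      calc _ ≤ (n : ℝ) * (3 * (1 / n)) := by gcongr
        _ = 3 := by field_simp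
    have h4 : 1 ≤ d * s := by nlinarith
    nlinarith
  -- Here 1 ≤ log n ≤ 2l gives log n ≤ (log n)² ≤ 4l², and 2 · 3 · 6 · 4 = 12².
  have h2 : √(2 * (3 * d ^ 2 * Real.log ((2 * (d * n) + 1 : ℕ) : ℝ))) ≤ 12 * (d * s * l) := by
    refine Real.sqrt_le_iff.mpr ⟨by positivity, ?_⟩
    have h3 := log_two_mul_mul_add_one_le hd hn
    have h4 : Real.log n ≤ 4 * l ^ 2 := by nlinarith
    calc 2 * (3 * d ^ 2 * Real.log ((2 * (d * n) + 1 : ℕ) : ℝ))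
        ≤ 2 * (3 * d ^ 2 * (6 * (Real.log d * (4 * l ^ 2)))) := by
          have := h3.trans (mul_le_mul_of_nonneg_left
            (mul_le_mul_of_nonneg_left h4 (by linarith)) (by norm_num))
          gcongr
      _ = (12 * (d * s * l)) ^ 2 := by rw [← hs2]; ring
  calc _ = 1 / n * (ρ * g * (√n * (3 * (1 / n))
          + √(2 * (3 * d ^ 2 * Real.log ((2 * (d * n) + 1 : ℕ) : ℝ))))) := by ring
    _ ≤ 1 / n * (ρ * g * (6 * (d * s * l) + 12 * (d * s * l))) := by gcongr
    _ = 18 * (ρ * d * g * s * l / n) := by ring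

end Main

theorem theorem1 :
    ∃ C : ℝ, 0 < C ∧ ∀ r₀ : ℝ, 0 < r₀ → ∃ n₀ : ℕ, 1 ≤ n₀ ∧ ∀ n : ℕ, n₀ ≤ n →
      ∀ (dx dh dy K t : ℕ) (Q : Type) (ρ ρh : ℝ≥0) (Bx BU BV BW : ℝ) (σ : ℝ → ℝ)
        (q : Vec dy → Q) (loss : Q → Fin K → ℝ) (S : Fin n → (Fin t → Vec dx) × Fin K),
        2 ≤ max dx (max dh dy) →
        0 ≤ Bx → 0 ≤ BU → 0 ≤ BV → 0 ≤ BW →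
        (∀ j : Fin t, frobNorm (inputsAt S j) ≤ Bx) →
        LipschitzWith ρh σ → σ 0 = 0 →
        (∀ z : Fin K, LipschitzWith ρ (fun y : Vec dy => loss (q y) z)) →
        -- (a) Frobenius norms only
        (r₀ ≤ rCoef ρh Bx BV BW BU t →
          BoundedOnSample (lossClass q loss (rnnClass dx dh dy σ BU BV BW t)) S ∧
          empRademacher (lossClass q loss (rnnClass dx dh dy σ BU BV BW t)) S
            ≤ C * rnnRate ρ ρh Bx BU BV BW BU t (max dx (max dh dy)) n) ∧
        -- (b) additional bound on the spectral norm of `U`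
        (∀ MU : ℝ, 0 ≤ MU → r₀ ≤ rCoef ρh Bx BV BW MU t →
          BoundedOnSample (lossClass q loss (rnnClassSpec dx dh dy σ BU MU BV BW t)) S ∧
          empRademacher (lossClass q loss (rnnClassSpec dx dh dy σ BU MU BV BW t)) S
            ≤ C * rnnRate ρ ρh Bx BU BV BW MU t (max dx (max dh dy)) n ∧
          (MU ≤ BU →
            rnnRate ρ ρh Bx BU BV BW MU t (max dx (max dh dy)) n
              ≤ rnnRate ρ ρh Bx BU BV BW BU t (max dx (max dh dy)) n)) := by
  -- 18 = 6 + 12 adds the discretisation and Massart terms. The threshold 3 > e gives log n ≥ 1, and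
  -- 1/r₀² gives log(n r) ≥ (log n)/2.
  refine ⟨18, by norm_num, fun r₀ hr₀ => ⟨max 3 ⌈1 / r₀ ^ 2⌉₊, by omega, ?_⟩⟩
  intro n hn dx dh dy K t Q ρ ρh Bx BU BV BW σ q loss S hd hBx hBU hBV hBW hS hσ hσ0 hloss
  have hn3 : 3 ≤ n := (le_max_left _ _).trans hn
  have hnr : 1 / r₀ ^ 2 ≤ (n : ℝ) := Nat.ceil_le.mp ((le_max_right _ _).trans hn)
  have hspec : ∀ MU : ℝ, 0 ≤ MU → r₀ ≤ rCoef ρh Bx BV BW MU t →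
      BoundedOnSample (lossClass q loss (rnnClassSpec dx dh dy σ BU MU BV BW t)) S ∧
      empRademacher (lossClass q loss (rnnClassSpec dx dh dy σ BU MU BV BW t)) S
        ≤ 18 * rnnRate ρ ρh Bx BU BV BW MU t (max dx (max dh dy)) n := fun MU hMU hr =>
    ⟨boundedOnSample_rnnClassSpec hMU hBx hBV hBW hS hσ hσ0 hloss,
      empRademacher_rnnClassSpec_le_rnnRate (by omega) (by omega) (by omega) hd hn3 hr₀ hnr hMU
        hBx hBU hBV hBW hS hσ hσ0 hloss hr⟩
  refine ⟨fun hr => ?_, fun MU hMU hr => ⟨(hspec MU hMU hr).1, (hspec MU hMU hr).2, fun h => ?_⟩⟩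
  · rw [rnnClass_eq_rnnClassSpec]
    exact hspec BU hBU hr
  · refine rnnRate_mono ρ.coe_nonneg ρh.coe_nonneg hBx hBU hBV hBW hMU h t _ n ?_
    have hn0 : (0 : ℝ) < n := by exact_mod_cast (by omega : 0 < n)
    -- Monotonicity of the rate needs a nonnegative logarithm, that is n r ≥ 1; this is read off
    -- from log(n r) ≥ (log n)/2 ≥ 0.
    have h1 := half_log_le_log_mul hr₀ hr hnr
    have h2 : 0 ≤ Real.log n := Real.log_natCast_nonneg n
    exact (Real.log_nonneg_iff (mul_pos hn0 (hr₀.trans_le hr))).mp (by linarith)
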